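/- Let $G$ be a group, $R$ a commutative ring with unit, and $\mathcal{F}$ a non-empty family of finite subgroups of $G$ that is closed under conjugation and under taking subgroups (for instance the family of all finite subgroups). The Hecke category $\mathcal{H}_{\mathcal{F}}$ has as objects the transitive $G$-sets $G/H$ with $H\in\mathcal{F}$, and its morphisms $G/H\to G/K$ are the $RG$-module homomorphisms $R[G/H]\to R[G/K]$. An $\mathcal{H}_{\mathcal{F}}$-module is a contravariant $R$-linear functor from $\mathcal{H}_{\mathcal{F}}$ to $R$-modules (equivalently, a cohomological Mackey functor on $\mathcal F$ with values in $R$-modules); a sequence of such modules is exact if it is exact at every object. For an $RG$-module $M$, the fixed point functor $M^-$ is the $\mathcal{H}_{\mathcal{F}}$-module $G/H\mapsto M^H$ which sends a homomorphism $f$ with $f(H)=\sum_x a_x\,xK$ to the map $M^K\to M^H$, $m\mapsto\sum_x a_x\,xm$. Let $\mathcal{H}_{\mathcal{F}}\mathrm{cd}\,G\in\mathbb{N}\cup\{\infty\}$ be the least $n$ such that $R^-$ ($R$ with trivial $G$-action) has a resolution $0\to P_n\to\cdots\to P_0\to R^-\to 0$ by projective $\mathcal{H}_{\mathcal{F}}$-modules,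 and $\infty$ if there is no such $n$. Let $\Delta=\coprod_{H\in\mathcal{F}}G/H$. An $RG$-module is $\mathcal{F}$-projective if it is a direct summand of $N\otimes_R R\Delta$ (with diagonal $G$-action) for some $RG$-module $N$. An exact sequence of $RG$-modules is $\mathcal{F}$-split if each of the short exact sequences into which it decomposes splits when restricted to $RH$, for every $H\in\mathcal{F}$. Let $\mathcal{F}\mathrm{cd}\,G\in\mathbb{N}\cup\{\infty\}$ be the least $n$ such that the trivial $RG$-module $R$ has an $\mathcal{F}$-split resolution $0\to P_n\to\cdots\to P_0\to R\to 0$ by $\mathcal{F}$-projective modules, and $\infty$ if there is no such $n$. Then, for all $G$, $R$ and $\mathcal{F}$ as above, $$\mathcal{F}\mathrm{cd}\,G=\mathcal{H}_{\mathcal{F}}\mathrm{cd}\,G .$$ -/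

import Mathlib

open CategoryTheory

universe u v

/-- A (non-empty) family of finite subgroups of `G`, closed under conjugation and under taking
subgroups. -/
structure FiniteSubgroupFamily (G : Type u) [Group G] where
  carrier : Set (Subgroup G)
  nonempty : carrier.Nonempty
  finite_of_mem : ∀ H ∈ carrier, Finite H
  conj_mem : ∀ H ∈ carrier, ∀ g : G, H.map (MulAut.conj g).toMonoidHom ∈ carrier
  mem_of_le : ∀ H ∈ carrier, ∀ K : Subgroup G, K ≤ H → K ∈ carrier

section HeckeModules

variable (R : Type v) [CommRing R] {G : Type u} [Group G] (F : FiniteSubgroupFamily G)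

/-- The permutation module `R[G/H]`. -/
noncomputable abbrev permModule (H : Subgroup G) : Rep.{max u v} R G :=
  Rep.ofMulAction R G (G ⧸ H)

/-- The Hecke category: its objects are the orbits `G/H` with `H ∈ F` (recorded by `H`), and
the morphisms `G/H ⟶ G/K` are the `RG`-module homomorphisms `R[G/H] → R[G/K]`. -/
abbrev HeckeCategory : Type u :=
  InducedCategory (Rep.{max u v} R G) (fun H : F.carrier => permModule R H.1)

/-- A contravariant functor from the Hecke category to `R`-modules is `R`-linear. -/
def IsHeckeLinear : ObjectProperty ((HeckeCategory R F)ᵒᵖ ⥤ ModuleCat.{max u v} R) :=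
  fun M => M.Additive ∧
    ∀ (X Y : HeckeCategory R F) (f : X ⟶ Y) (r : R), M.map (r • f).op = r • M.map f.op

/-- The category of (contravariant) modules over the Hecke category. -/
abbrev HeckeModule := (IsHeckeLinear R F).FullSubcategory

variable {R F}

/-- Evaluation of a morphism of Hecke modules at `G/H`. -/
noncomputable abbrev HeckeModule.evalMap {M N : HeckeModule R F} (f : M ⟶ N)
    (H : HeckeCategory R F) : M.obj.obj (Opposite.op H) →ₗ[R] N.obj.obj (Opposite.op H) :=
  (f.hom.app (Opposite.op H)).hom

end HeckeModules

section FixedPoints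

variable {R : Type v} [CommRing R] {G : Type u} [Group G]

/-- The fixed points `M^H`. -/
noncomputable abbrev fixedPts (M : Rep.{max u v} R G) (H : Subgroup G) : Submodule R M.V :=
  Representation.invariants (M.ρ.comp H.subtype)

/-- For `m ∈ M^K`, the `R`-linear map `R[G/K] → M` sending `gK` to `g m`. -/
noncomputable def orbitMap (M : Rep.{max u v} R G) (K : Subgroup G) (m : fixedPts M K) :
    (permModule R K).V →ₗ[R] M.V :=
  (Finsupp.linearCombination R (fun x : G ⧸ K => Quotient.liftOn' x (fun g => M.ρ g m.1)
    (by
      intro a b hab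
      have h1 := m.2 ⟨a⁻¹ * b, QuotientGroup.leftRel_apply.mp hab⟩
      have h2 : M.ρ (a⁻¹ * b) m.1 = m.1 := h1
      calc M.ρ a m.1 = M.ρ a (M.ρ (a⁻¹ * b) m.1) := by rw [h2]
        _ = M.ρ b m.1 := by
          rw [← Module.End.mul_apply, ← map_mul, mul_inv_cancel_left]))) ∘ₗ
    (MonoidAlgebra.coeffLinearEquiv R).toLinearMap

/-- The basis element `gK` of `R[G/K]`. -/
noncomputable def cosetElt (R : Type v) [CommRing R] (K : Subgroup G) (g : G) :
    (permModule R K).V :=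
  MonoidAlgebra.single (g : G ⧸ K) (1 : R)

theorem orbitMap_cosetElt (M : Rep.{max u v} R G) (K : Subgroup G) (m : fixedPts M K) (g : G) :
    orbitMap M K m (cosetElt R K g) = M.ρ g m.1 := by
  simp [orbitMap, cosetElt]

theorem permModule_ρ_cosetElt (K : Subgroup G) (g x : G) :
    (permModule R K).ρ g (cosetElt R K x) = cosetElt R K (g * x) := by
  simp [cosetElt]

theorem permModule_hom_ext {K : Subgroup G} {V : Type*} [AddCommGroup V] [Module R V]
    {f g : (permModule R K).V →ₗ[R] V}
    (h : ∀ x : G, f (cosetElt R K x) = g (cosetElt R K x)) : f = g := by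
  apply MonoidAlgebra.lhom_ext'
  intro x
  induction x using QuotientGroup.induction_on with
  | H x =>
    ext
    exact h x

theorem orbitMap_equivariant (M : Rep.{max u v} R G) (K : Subgroup G) (m : fixedPts M K) (g : G)
    (y : (permModule R K).V) :
    orbitMap M K m ((permModule R K).ρ g y) = M.ρ g (orbitMap M K m y) := by
  have : orbitMap M K m ∘ₗ (permModule R K).ρ g = M.ρ g ∘ₗ orbitMap M K m := by
    apply permModule_hom_ext
    intro x
    rw [LinearMap.comp_apply, LinearMap.comp_apply, permModule_ρ_cosetElt, orbitMap_cosetElt,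
      orbitMap_cosetElt, map_mul, Module.End.mul_apply]
  exact congrArg (fun l => l y) this

theorem orbitMap_add (M : Rep.{max u v} R G) (K : Subgroup G) (m m' : fixedPts M K) :
    orbitMap M K (m + m') = orbitMap M K m + orbitMap M K m' := by
  apply permModule_hom_ext
  intro x
  rw [LinearMap.add_apply, orbitMap_cosetElt, orbitMap_cosetElt, orbitMap_cosetElt,
    Submodule.coe_add, map_add]

theorem orbitMap_smul (M : Rep.{max u v} R G) (K : Subgroup G) (r : R) (m : fixedPts M K) :
    orbitMap M K (r • m) = r • orbitMap M K m := by
  apply permModule_hom_ext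
  intro x
  rw [LinearMap.smul_apply, orbitMap_cosetElt, orbitMap_cosetElt, Submodule.coe_smul, map_smul]

theorem cosetElt_fixed (H : Subgroup G) (h : H) :
    (permModule R H).ρ h (cosetElt R H 1) = cosetElt R H 1 := by
  rw [permModule_ρ_cosetElt, cosetElt, cosetElt]
  congr 1
  rw [mul_one]
  exact QuotientGroup.eq.mpr (by simp)

/-- For an `RG`-homomorphism `f : R[G/H] → R[G/K]` with `f(H) = ∑ a_x xK`, the map
`M^K → M^H`, `m ↦ ∑ a_x x m`. -/
noncomputable def fixedPtsMap (M : Rep.{max u v} R G) {H K : Subgroup G}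
    (f : permModule R H ⟶ permModule R K) : fixedPts M K →ₗ[R] fixedPts M H where
  toFun m := ⟨orbitMap M K m (f.hom (cosetElt R H 1)), fun h => by
    change M.ρ h _ = _
    rw [← orbitMap_equivariant, ← Rep.hom_comm_apply, cosetElt_fixed]⟩
  map_add' m m' := by
    ext
    simp [orbitMap_add]
  map_smul' r m := by
    ext
    simp [orbitMap_smul]

theorem orbitMap_fixedPtsMap (M : Rep.{max u v} R G) {H K : Subgroup G}
    (f : permModule R H ⟶ permModule R K) (m : fixedPts M K) :
    orbitMap M H (fixedPtsMap M f m) = orbitMap M K m ∘ₗ f.hom.toLinearMap := by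
  apply permModule_hom_ext
  intro x
  have hx : cosetElt R H x = (permModule R H).ρ x (cosetElt R H 1) := by
    rw [permModule_ρ_cosetElt, mul_one]
  rw [orbitMap_cosetElt, LinearMap.comp_apply, Representation.IntertwiningMap.toLinearMap_apply,
    hx, Rep.hom_comm_apply, orbitMap_equivariant]
  rfl

variable (F : FiniteSubgroupFamily G)

/-- The fixed point functor `M^- : G/H ↦ M^H`, as a module over the Hecke category. -/
noncomputable def fixedPointFunctor (M : Rep.{max u v} R G) : HeckeModule R F where
  obj :=
    { obj := fun H => ModuleCat.of R (fixedPts M H.unop.1)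
      map := fun f => ModuleCat.ofHom (fixedPtsMap M f.unop.hom)
      map_id := fun H => by
        ext m
        change orbitMap M _ m (cosetElt R _ 1) = m.1
        rw [orbitMap_cosetElt, map_one, Module.End.one_apply]
      map_comp := fun {X Y Z} f g => by
        ext m
        change orbitMap M _ m (f.unop.hom.hom (g.unop.hom.hom (cosetElt R _ 1))) =
          orbitMap M _ (fixedPtsMap M f.unop.hom m) (g.unop.hom.hom (cosetElt R _ 1))
        rw [orbitMap_fixedPtsMap]
        rfl }
  property := by
    refine ⟨⟨fun {X Y} {f g} => ?_⟩, fun X Y f r => ?_⟩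
    · ext m
      exact map_add (orbitMap M _ m) _ _
    · ext m
      exact map_smul (orbitMap M _ m) _ _

end FixedPoints

section Dimensions

variable (R : Type v) [CommRing R] {G : Type u} [Group G] (F : FiniteSubgroupFamily G)

/-- The trivial `RG`-module `R` (lifted to the universe of the modules considered). -/
noncomputable abbrev trivialRep (G : Type u) [Group G] : Rep.{max u v} R G :=
  Rep.trivial R G (ULift.{u} R)

/-- A resolution `0 → P_n → ⋯ → P_0 → R^- → 0` of `R^-` by projective modules over the Hecke
category; exactness of sequences of Hecke modules is exactness at every object. -/
structure HeckeResolution (n : ℕ) where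
  P : ℕ → HeckeModule R F
  d : ∀ i, P (i + 1) ⟶ P i
  ε : P 0 ⟶ fixedPointFunctor F (trivialRep R G)
  projective : ∀ i, Projective (P i)
  isZero : ∀ i, n < i → Limits.IsZero (P i)
  surjective : ∀ H, Function.Surjective (HeckeModule.evalMap ε H)
  exact_zero : ∀ H, Function.Exact (HeckeModule.evalMap (d 0) H) (HeckeModule.evalMap ε H)
  exact_succ : ∀ i H, Function.Exact (HeckeModule.evalMap (d (i + 1)) H)
    (HeckeModule.evalMap (d i) H)

/-- The Hecke cohomological dimension of `G`: the length of a shortest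
projective resolution of `R^-` by Hecke modules (`⊤` if there is none of finite length). -/
noncomputable def heckeCd : ℕ∞ :=
  ⨅ (n : ℕ) (_ : Nonempty (HeckeResolution R F n)), (n : ℕ∞)

variable {R}

/-- The `G`-set `Δ = ∐_{H ∈ F} G/H`. -/
abbrev FiniteSubgroupFamily.Delta : Type u := Σ H : F.carrier, G ⧸ H.1

/-- An `RG`-module is `F`-projective if it is a direct summand of `N ⊗ RΔ` (with the diagonal
action) for some `RG`-module `N`. -/
def IsFProjective (M : Rep.{max u v} R G) : Prop :=
  ∃ N : Rep.{max u v} R G,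
    Nonempty (Retract M (Rep.of (N.ρ.tprod (Representation.ofMulAction R G F.Delta))))

/-- The short exact sequence `0 → ker f → A → im f → 0` splits when restricted to `RH`. -/
def SplitsOver (H : Subgroup G) {A B : Rep.{max u v} R G} (f : A ⟶ B) : Prop :=
  ∃ s : Representation.IntertwiningMap
      (f.hom.range.toRepresentation.comp H.subtype) (A.ρ.comp H.subtype),
    ∀ y, f.hom (s y) = (y : B.V)

variable (R)

/-- An `F`-split resolution `0 → P_n → ⋯ → P_0 → R → 0` of the trivial module `R` by
`F`-projective modules: an exact sequence such that each of the short exact sequences into which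
it decomposes splits over `RH` for every `H ∈ F`. -/
structure FSplitResolution (n : ℕ) where
  P : ℕ → Rep.{max u v} R G
  d : ∀ i, P (i + 1) ⟶ P i
  ε : P 0 ⟶ trivialRep R G
  projective : ∀ i, IsFProjective F (P i)
  isZero : ∀ i, n < i → Limits.IsZero (P i)
  surjective : Function.Surjective ε.hom
  exact_zero : Function.Exact (d 0).hom ε.hom
  exact_succ : ∀ i, Function.Exact (d (i + 1)).hom (d i).hom
  split_zero : ∀ H ∈ F.carrier, SplitsOver H ε
  split_succ : ∀ H ∈ F.carrier, ∀ i, SplitsOver H (d i)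

/-- The `F`-cohomological dimension of `G`: the length of a shortest `F`-split resolution of `R` by
`F`-projective modules (`⊤` if there is none of finite length). -/
noncomputable def familyCd : ℕ∞ :=
  ⨅ (n : ℕ) (_ : Nonempty (FSplitResolution R F n)), (n : ℕ∞)

end Dimensions

/-!
The equality holds because both dimensions are computed by one kind of resolution: a
`PermResolution`, which resolves `R` by direct summands of permutation modules `R[∐ G/Hᵢ]` with
`Hᵢ ∈ F` and is exact on `H`-fixed points for every `H ∈ F`. It is shown that a `HeckeResolution` of
length `n` exists iff a `PermResolution` vanishing above `n` exists iff an `FSplitResolution` of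
length `n` exists.

*Hecke modules.* By the Yoneda lemma, the fixed point functor of `R[∐ G/Hᵢ]` is the coproduct of the
functors represented by the `G/Hᵢ` (`permSumDesc`, `eq_permSumDesc`), so it is projective, and every
Hecke module is a quotient of such a functor. Since `M ↦ M^-` is fully faithful
(`fixedPointMap_surjective`, `fixedPointMap_injective`) and idempotents split in `Rep R G`, the
projective Hecke modules are the functors `M^-` with `M` a direct summand of a permutation module
(`exists_iso_fixedPointFunctor`). Hence Hecke resolutions and `PermResolution`s are the same thing.

*From fixed points to `F`-splitness.* Over `H ∈ F` a permutation module has the lifting property for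
maps that are surjective on `L`-fixed points, `L ≤ H` (`IsPermProjective.exists_lift`). As `R`
itself is such a module over `H`, a `PermResolution` is contractible over `H`, hence `F`-split
(`PermResolution.exists_contraction`); its terms are `F`-projective because `R[X]` is a direct
summand of `R[X] ⊗ RΔ`.

*From `F`-split resolutions to fixed points.* An `F`-projective module `N ⊗ RΔ` need not give a
projective Hecke module, so an `F`-split resolution `D` of length `n` is compared with some
`PermResolution` `C`, which always exists. `F`-projective modules lift along `F`-split maps
(`IsFProjective.exists_lift`), so `C` and `D` are chain homotopy equivalent. Since `D` vanishes
above `n`, the differential of `C` satisfies `d = dhd` from degree `n` on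
(`exists_homotopy_of_isZero`), and the truncation of `C` in degree `n` is a direct summand of `C`
(`exists_truncation_idempotent`), hence again a `PermResolution`.

Both lifting properties come from `exists_equivariant_selection`.
-/

/-! ### Permutation modules -/

section PermutationModules

variable {R : Type v} [CommRing R] {G : Type u} [Group G]

/-- The `RG`-homomorphism `R[X] → M` extending an equivariant map `X → M` on a `G`-set `X`. -/
noncomputable def permLift {X : Type max u v} [MulAction G X] (M : Rep.{max u v} R G) (f : X → M.V)
    (hf : ∀ (g : G) x, f (g • x) = M.ρ g (f x)) : Rep.ofMulAction R G X ⟶ M :=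
  Rep.ofHom ⟨Finsupp.linearCombination R f ∘ₗ (MonoidAlgebra.coeffLinearEquiv R).toLinearMap,
    fun g => by
      apply MonoidAlgebra.lhom_ext'
      intro x
      ext
      simp [hf]⟩

theorem permLift_single {X : Type max u v} [MulAction G X] (M : Rep.{max u v} R G) (f : X → M.V)
    (hf : ∀ (g : G) x, f (g • x) = M.ρ g (f x)) (x : X) :
    (permLift M f hf).hom (MonoidAlgebra.single x (1 : R)) = f x := by
  change (Finsupp.linearCombination R f ∘ₗ (MonoidAlgebra.coeffLinearEquiv R).toLinearMap)
    (MonoidAlgebra.single x (1 : R)) = f x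
  simp

theorem ofMulAction_hom_ext {X : Type max u v} [MulAction G X] {M : Rep.{max u v} R G}
    {f g : Rep.ofMulAction R G X ⟶ M}
    (h : ∀ x : X, f.hom (MonoidAlgebra.single x (1 : R)) = g.hom (MonoidAlgebra.single x (1 : R))) :
    f = g := by
  apply Rep.hom_ext
  apply Representation.IntertwiningMap.ext
  apply MonoidAlgebra.lhom_ext'
  intro x
  ext
  exact h x

theorem permModule_mor_ext {M : Rep.{max u v} R G} {K : Subgroup G} {f g : permModule R K ⟶ M}
    (h : f.hom (cosetElt R K 1) = g.hom (cosetElt R K 1)) : f = g := by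
  apply Rep.hom_ext
  apply Representation.IntertwiningMap.ext
  apply permModule_hom_ext
  intro x
  have hx : cosetElt R K x = (permModule R K).ρ x (cosetElt R K 1) := by
    rw [permModule_ρ_cosetElt, mul_one]
  rw [Representation.IntertwiningMap.toLinearMap_apply,
    Representation.IntertwiningMap.toLinearMap_apply, hx, Rep.hom_comm_apply, Rep.hom_comm_apply, h]

theorem hom_mem_fixedPts {M N : Rep.{max u v} R G} (f : M ⟶ N) {H : Subgroup G} {m : M.V}
    (hm : m ∈ fixedPts M H) : f.hom m ∈ fixedPts N H := fun h => by
  have h1 : M.ρ h m = m := hm h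
  change N.ρ h (f.hom m) = f.hom m
  rw [← Rep.hom_comm_apply, h1]

variable (R) {F : FiniteSubgroupFamily G}

/-- The permutation module `R[∐ G/Hᵢ]` of a family of subgroups in `F`. -/
noncomputable abbrev permSum {I : Type max u v} (H : I → F.carrier) : Rep.{max u v} R G :=
  Rep.ofMulAction R G (Σ i, G ⧸ (H i).1)

variable {R} {I : Type max u v} (H : I → F.carrier)

/-- The inclusion of the `i`-th summand `R[G/Hᵢ]` in `R[∐ G/Hᵢ]`. -/
noncomputable def permSumι (i : I) : permModule R (H i).1 ⟶ permSum R H :=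
  Rep.ofHom ⟨Finsupp.linearCombination R
      (fun x => (MonoidAlgebra.single ⟨i, x⟩ 1 : (permSum R H).V)) ∘ₗ
        (MonoidAlgebra.coeffLinearEquiv R).toLinearMap, fun g => by
      apply MonoidAlgebra.lhom_ext'
      intro x
      ext1
      simp⟩

theorem permSumι_single (i : I) (x : G ⧸ (H i).1) :
    (permSumι H i).hom (MonoidAlgebra.single x (1 : R)) = MonoidAlgebra.single ⟨i, x⟩ 1 := by
  change (Finsupp.linearCombination R
      (fun x => (MonoidAlgebra.single ⟨i, x⟩ 1 : (permSum R H).V)) ∘ₗ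
        (MonoidAlgebra.coeffLinearEquiv R).toLinearMap) _ = _
  simp

open Classical in
/-- The projection of `R[∐ G/Hᵢ]` onto its `i`-th summand `R[G/Hᵢ]`. -/
noncomputable def permSumπ (i : I) : permSum R H ⟶ permModule R (H i).1 :=
  permLift _ (fun x => if h : x.1 = i then MonoidAlgebra.single (h ▸ x.2) 1 else 0) (by
    rintro g ⟨j, x⟩
    by_cases h : j = i
    · subst h
      simp
    · simp [h])

theorem permSumπ_single_self (i : I) (x : G ⧸ (H i).1) :
    (permSumπ H i).hom (MonoidAlgebra.single ⟨i, x⟩ (1 : R)) = MonoidAlgebra.single x 1 := by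
  rw [permSumπ, permLift_single]
  simp

theorem permSumπ_single_of_ne {i j : I} (h : j ≠ i) (x : G ⧸ (H j).1) :
    (permSumπ H i).hom (MonoidAlgebra.single ⟨j, x⟩ (1 : R)) = 0 := by
  rw [permSumπ, permLift_single]
  simp [h]

theorem permSumι_π_self (i : I) : permSumι (R := R) H i ≫ permSumπ H i = 𝟙 _ := by
  apply permModule_mor_ext
  change (permSumπ H i).hom ((permSumι H i).hom (MonoidAlgebra.single _ 1)) = _
  rw [permSumι_single, permSumπ_single_self]
  rfl

theorem permSumι_π_of_ne {i j : I} (h : j ≠ i) : permSumι (R := R) H j ≫ permSumπ H i = 0 := by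
  apply permModule_mor_ext
  change (permSumπ H i).hom ((permSumι H j).hom (MonoidAlgebra.single _ 1)) = _
  rw [permSumι_single, permSumπ_single_of_ne H h]
  rfl

theorem finite_permSumπ_ne_zero (y : (permSum R H).V) : {i | (permSumπ H i).hom y ≠ 0}.Finite := by
  induction y using MonoidAlgebra.induction_linear with
  | zero => simp
  | add y z hy hz =>
    refine (hy.union hz).subset fun i hi => ?_
    by_contra hc
    simp only [Set.mem_union, Set.mem_ofPred_eq, not_or, not_not] at hc
    exact hi (by rw [map_add, hc.1, hc.2, add_zero])
  | single x r =>
    refine (Set.finite_singleton x.1).subset fun i hi => ?_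
    by_contra hc
    refine hi ?_
    have h1 : (MonoidAlgebra.single x r : (permSum R H).V) = r • MonoidAlgebra.single x 1 := by simp
    obtain ⟨j, x⟩ := x
    rw [h1, map_smul, permSumπ_single_of_ne H (fun h => hc (by simp [h])), smul_zero]

theorem finsum_permSumι_π (y : (permSum R H).V) :
    ∑ᶠ i, (permSumι H i).hom ((permSumπ H i).hom y) = y := by
  have hfin (y : (permSum R H).V) :
      (Function.support fun i => (permSumι H i).hom ((permSumπ H i).hom y)).Finite :=
    (finite_permSumπ_ne_zero H y).subset fun i hi h => hi (by simp [h])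
  induction y using MonoidAlgebra.induction_linear with
  | zero => simp
  | add y z hy hz =>
    simp only [map_add]
    rw [finsum_add_distrib (hfin y) (hfin z), hy, hz]
  | single x r =>
    have h1 : (MonoidAlgebra.single x r : (permSum R H).V) = r • MonoidAlgebra.single x 1 := by simp
    obtain ⟨j, x⟩ := x
    rw [h1, finsum_eq_single _ j, map_smul, map_smul, permSumπ_single_self, permSumι_single]
    intro i hi
    rw [map_smul, permSumπ_single_of_ne H hi.symm, smul_zero, map_zero]

end PermutationModules

/-! ### Hecke modules -/

section HeckeModuleAPI

variable {R : Type v} [CommRing R] {G : Type u} [Group G] {F : FiniteSubgroupFamily G}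

variable (R) in
/-- The orbit `G/H`, as an object of the Hecke category. -/
abbrev heckeObj (H : F.carrier) : HeckeCategory R F := H

/-- An `RG`-homomorphism `R[G/H] → R[G/K]`, as a morphism of the Hecke category. -/
noncomputable abbrev heckeHom {H K : F.carrier} (f : permModule R H.1 ⟶ permModule R K.1) :
    heckeObj R H ⟶ heckeObj R K :=
  InducedCategory.homMk (X := heckeObj R H) (Y := heckeObj R K) f

/-- The value of a Hecke module at `G/H`. -/
abbrev HeckeModule.val (P : HeckeModule R F) (H : F.carrier) : Type max u v :=
  P.obj.obj (Opposite.op (heckeObj R H))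

/-- The map `P(G/K) → P(G/H)` induced by an `RG`-homomorphism `R[G/H] → R[G/K]`. -/
noncomputable def HeckeModule.act (P : HeckeModule R F) {H K : F.carrier}
    (f : permModule R H.1 ⟶ permModule R K.1) : P.val K →ₗ[R] P.val H :=
  (P.obj.map (heckeHom f).op).hom

namespace HeckeModule

variable (P Q : HeckeModule R F) {H K L : F.carrier}

theorem act_id (p : P.val H) : P.act (𝟙 (permModule R H.1)) p = p :=
  congr($(P.obj.map_id (Opposite.op (heckeObj R H))).hom p)

theorem act_comp (f : permModule R H.1 ⟶ permModule R K.1)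
    (g : permModule R K.1 ⟶ permModule R L.1) (p : P.val L) :
    P.act (f ≫ g) p = P.act f (P.act g p) :=
  congr($(P.obj.map_comp (heckeHom g).op (heckeHom f).op).hom p)

theorem act_add (f g : permModule R H.1 ⟶ permModule R K.1) : P.act (f + g) = P.act f + P.act g :=
  congr($(P.property.1.map_add (f := (heckeHom f).op) (g := (heckeHom g).op)).hom)

theorem act_smul (r : R) (f : permModule R H.1 ⟶ permModule R K.1) :
    P.act (r • f) = r • P.act f :=
  congr($(P.property.2 _ _ (heckeHom f) r).hom)

theorem act_zero : P.act (0 : permModule R H.1 ⟶ permModule R K.1) = 0 := by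
  simpa using P.act_smul 0 (0 : permModule R H.1 ⟶ permModule R K.1)

variable {P Q}

/-- The component at `G/H` of a morphism of Hecke modules. -/
noncomputable abbrev eval (f : P ⟶ Q) (H : F.carrier) : P.val H →ₗ[R] Q.val H :=
  evalMap f (heckeObj R H)

theorem eval_act (η : P ⟶ Q) (f : permModule R H.1 ⟶ permModule R K.1) (p : P.val K) :
    eval η H (P.act f p) = Q.act f (eval η K p) :=
  congr($(η.hom.naturality (heckeHom f).op).hom p)

theorem eval_comp {S : HeckeModule R F} (f : P ⟶ Q) (g : Q ⟶ S) (p : P.val H) :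
    eval (f ≫ g) H p = eval g H (eval f H p) := rfl

theorem hom_ext {f g : P ⟶ Q} (h : ∀ H p, eval f H p = eval g H p) : f = g := by
  apply ObjectProperty.hom_ext
  ext H p
  exact h H.unop p

/-- A morphism of Hecke modules from a compatible family of linear maps. -/
noncomputable def mkHom (φ : ∀ H : F.carrier, P.val H →ₗ[R] Q.val H)
    (hφ : ∀ {H K : F.carrier} (f : permModule R H.1 ⟶ permModule R K.1) (p : P.val K),
      φ H (P.act f p) = Q.act f (φ K p)) : P ⟶ Q :=
  ObjectProperty.homMk
    { app := fun H => ModuleCat.ofHom (φ H.unop)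
      naturality := fun _ _ f => ModuleCat.hom_ext (LinearMap.ext fun p => hφ f.unop.hom p) }

variable (R F) in
/-- A Hecke module from its values and the maps between them. -/
noncomputable def mkObj (V : F.carrier → ModuleCat.{max u v} R)
    (a : ∀ {H K : F.carrier}, (permModule R H.1 ⟶ permModule R K.1) → (V K →ₗ[R] V H))
    (a_id : ∀ {H : F.carrier} (x : V H), a (𝟙 (permModule R H.1)) x = x)
    (a_comp : ∀ {H K L : F.carrier} (f : permModule R H.1 ⟶ permModule R K.1)
      (g : permModule R K.1 ⟶ permModule R L.1) (x : V L), a (f ≫ g) x = a f (a g x))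
    (a_add : ∀ {H K : F.carrier} (f g : permModule R H.1 ⟶ permModule R K.1) (x : V K),
      a (f + g) x = a f x + a g x)
    (a_smul : ∀ {H K : F.carrier} (r : R) (f : permModule R H.1 ⟶ permModule R K.1) (x : V K),
      a (r • f) x = r • a f x) : HeckeModule R F where
  obj :=
    { obj := fun H => V H.unop
      map := fun f => ModuleCat.ofHom (a f.unop.hom)
      map_id := fun _ => ModuleCat.hom_ext (LinearMap.ext fun x => a_id x)
      map_comp := fun f g =>
        ModuleCat.hom_ext (LinearMap.ext fun x => a_comp g.unop.hom f.unop.hom x) }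
  property :=
    ⟨⟨fun {_ _} {f g} => ModuleCat.hom_ext (LinearMap.ext fun x => a_add f.unop.hom g.unop.hom x)⟩,
      fun _ _ f r => ModuleCat.hom_ext (LinearMap.ext fun x => a_smul r f.hom x)⟩

/-- The cokernel of a morphism of Hecke modules, computed objectwise. -/
noncomputable def coker (η : P ⟶ Q) : HeckeModule R F :=
  mkObj R F (fun H => ModuleCat.of R (Q.val H ⧸ LinearMap.range (eval η H)))
    (fun {H K} f => Submodule.mapQ (LinearMap.range (eval η K)) (LinearMap.range (eval η H))
      (Q.act f) (by
        rintro _ ⟨p, rfl⟩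
        exact ⟨P.act f p, eval_act η f p⟩))
    (fun x => by
      obtain ⟨x, rfl⟩ := Submodule.mkQ_surjective _ x
      exact congrArg (Submodule.mkQ _) (Q.act_id x))
    (fun f g x => by
      obtain ⟨x, rfl⟩ := Submodule.mkQ_surjective _ x
      exact congrArg (Submodule.mkQ _) (Q.act_comp f g x))
    (fun f g x => by
      obtain ⟨x, rfl⟩ := Submodule.mkQ_surjective _ x
      exact congrArg (Submodule.mkQ _) congr($(Q.act_add f g) x))
    (fun r f x => by
      obtain ⟨x, rfl⟩ := Submodule.mkQ_surjective _ x
      exact congrArg (Submodule.mkQ _) congr($(Q.act_smul r f) x))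

/-- Epimorphisms of Hecke modules are objectwise surjective. -/
theorem surjective_of_epi (η : P ⟶ Q) [Epi η] (H : F.carrier) :
    Function.Surjective (eval η H) := by
  let π : Q ⟶ coker η := mkHom (fun H => Submodule.mkQ (LinearMap.range (eval η H)))
    (fun f p => rfl)
  let z : Q ⟶ coker η := mkHom (fun H => 0) (fun f p => by
    rw [LinearMap.zero_apply, LinearMap.zero_apply, map_zero])
  have h : π = z := by
    rw [← cancel_epi η]
    refine hom_ext fun H p => ?_
    exact (Submodule.Quotient.mk_eq_zero _).2 ⟨p, rfl⟩
  intro q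
  exact (Submodule.Quotient.mk_eq_zero _).1 (congr(eval $h H q))

theorem epi_of_surjective (η : P ⟶ Q) (h : ∀ H : F.carrier, Function.Surjective (eval η H)) :
    Epi η where
  left_cancellation f g hfg := by
    refine hom_ext fun H q => ?_
    obtain ⟨p, rfl⟩ := h H q
    exact congr(eval $hfg H p)

end HeckeModule

end HeckeModuleAPI

/-! ### The fixed point functor is fully faithful -/

section FixedPointFunctor

variable {R : Type v} [CommRing R] {G : Type u} [Group G] (F : FiniteSubgroupFamily G)

open HeckeModule

variable {F} in
/-- The inclusion of the value `M^H` of the fixed point functor at `G/H` in `M`. -/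
noncomputable def fixedPtsVal (M : Rep.{max u v} R G) (H : F.carrier) :
    (fixedPointFunctor F M).val H →ₗ[R] M.V :=
  (fixedPts M H.1).subtype

variable {F} in
/-- An element of `M^H`, as an element of the value of the fixed point functor at `G/H`. -/
noncomputable def fixedPtsMk {M : Rep.{max u v} R G} {H : F.carrier} (m : M.V)
    (hm : m ∈ fixedPts M H.1) : (fixedPointFunctor F M).val H :=
  (⟨m, hm⟩ : fixedPts M H.1)

variable {F} {M N : Rep.{max u v} R G} {H K : F.carrier}

@[simp]
theorem fixedPtsVal_mk (m : M.V) (hm : m ∈ fixedPts M H.1) :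
    fixedPtsVal M H (fixedPtsMk m hm) = m := rfl

theorem fixedPtsVal_mem (m : (fixedPointFunctor F M).val H) :
    fixedPtsVal M H m ∈ fixedPts M H.1 :=
  Subtype.property (p := fun m => m ∈ fixedPts M H.1) m

theorem fixedPtsVal_injective : Function.Injective (fixedPtsVal M H) :=
  Subtype.val_injective

/-- For `m ∈ M^H`, the `RG`-homomorphism `R[G/H] → M` sending `gH` to `g m`. -/
noncomputable def orbitHom (m : (fixedPointFunctor F M).val H) : permModule R H.1 ⟶ M :=
  Rep.ofHom ⟨orbitMap M H.1 m, fun g => LinearMap.ext (orbitMap_equivariant M H.1 m g)⟩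

theorem orbitHom_cosetElt (m : (fixedPointFunctor F M).val H) (g : G) :
    (orbitHom m).hom (cosetElt R H.1 g) = M.ρ g (fixedPtsVal M H m) :=
  orbitMap_cosetElt M H.1 m g

@[simp]
theorem orbitHom_cosetElt_one (m : (fixedPointFunctor F M).val H) :
    (orbitHom m).hom (cosetElt R H.1 1) = fixedPtsVal M H m := by
  rw [orbitHom_cosetElt, map_one, Module.End.one_apply]

theorem fixedPtsVal_act (f : permModule R H.1 ⟶ permModule R K.1)
    (m : (fixedPointFunctor F M).val K) :
    fixedPtsVal M H ((fixedPointFunctor F M).act f m) =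
      (orbitHom m).hom (f.hom (cosetElt R H.1 1)) := rfl

theorem orbitHom_act (f : permModule R H.1 ⟶ permModule R K.1)
    (m : (fixedPointFunctor F M).val K) :
    orbitHom ((fixedPointFunctor F M).act f m) = f ≫ orbitHom m := by
  apply permModule_mor_ext
  rw [orbitHom_cosetElt_one]
  rfl

variable (F) in
/-- The morphism of fixed point functors induced by an `RG`-homomorphism. -/
noncomputable def fixedPointMap (f : M ⟶ N) : fixedPointFunctor F M ⟶ fixedPointFunctor F N :=
  mkHom
    (fun H => ((f.hom.toLinearMap).restrict (p := fixedPts M H.1) (q := fixedPts N H.1)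
      fun m hm => hom_mem_fixedPts f hm : fixedPts M H.1 →ₗ[R] fixedPts N H.1))
    (fun {H K} g m => by
      apply fixedPtsVal_injective
      have h : orbitHom m ≫ f = orbitHom (fixedPtsMk (F := F) (f.hom (fixedPtsVal M K m))
          (hom_mem_fixedPts f (fixedPtsVal_mem m))) := by
        apply permModule_mor_ext
        rw [orbitHom_cosetElt_one, fixedPtsVal_mk, ← orbitHom_cosetElt_one]
        rfl
      exact congr(($h).hom (g.hom (cosetElt R H.1 1))))

variable (F) in
/-- The functor `M ↦ M^-` from `RG`-modules to Hecke modules. -/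
noncomputable def fixedPointFunctorial : Rep.{max u v} R G ⥤ HeckeModule R F where
  obj M := fixedPointFunctor F M
  map f := fixedPointMap F f

instance : (fixedPointFunctorial (R := R) F).Additive where
  map_add := rfl

theorem FiniteSubgroupFamily.bot_mem (F : FiniteSubgroupFamily G) : ⊥ ∈ F.carrier := by
  obtain ⟨H, hH⟩ := F.nonempty
  exact F.mem_of_le H hH ⊥ bot_le

/-- The trivial subgroup, as a member of `F`. -/
abbrev FiniteSubgroupFamily.bot (F : FiniteSubgroupFamily G) : F.carrier := ⟨⊥, F.bot_mem⟩

theorem mem_fixedPts_bot (M : Rep.{max u v} R G) (m : M.V) : m ∈ fixedPts M (⊥ : Subgroup G) := by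
  rintro ⟨h, hh⟩
  obtain rfl := Subgroup.mem_bot.1 hh
  change M.ρ 1 m = m
  rw [map_one, Module.End.one_apply]

/-- The fixed point functor is full: a morphism `M^- → N^-` is determined by its value
`M → N` at the free orbit, whose equivariance follows from naturality for the right
translations `R[G] → R[G]`. -/
theorem fixedPointMap_surjective (η : fixedPointFunctor F M ⟶ fixedPointFunctor F N) :
    ∃ f : M ⟶ N, fixedPointMap F f = η := by
  let φ : M.V →ₗ[R] N.V := fixedPtsVal N F.bot ∘ₗ (eval η F.bot) ∘ₗ
    (LinearMap.id.codRestrict (fixedPts M (⊥ : Subgroup G)) (mem_fixedPts_bot M))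
  have hφ (m : (fixedPointFunctor F M).val F.bot) :
      φ (fixedPtsVal M _ m) = fixedPtsVal N _ (eval η F.bot m) := rfl
  -- the element `gH` of `R[G/H]` gives a map `R[G] → R[G/H]` inducing `m ↦ g m`, `M^H → M`
  have hact {H : F.carrier} (g : G) (M : Rep.{max u v} R G) (m : (fixedPointFunctor F M).val H) :
      fixedPtsVal M F.bot ((fixedPointFunctor F M).act (orbitHom (fixedPtsMk (cosetElt R H.1 g)
        (mem_fixedPts_bot _ _))) m) = M.ρ g (fixedPtsVal M H m) := by
    rw [fixedPtsVal_act, orbitHom_cosetElt_one, fixedPtsVal_mk, orbitHom_cosetElt]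
  have key {H : F.carrier} (g : G) (m : (fixedPointFunctor F M).val H) :
      φ (M.ρ g (fixedPtsVal M H m)) = N.ρ g (fixedPtsVal N H (eval η H m)) := by
    rw [← hact, ← hact, hφ, eval_act]
  refine ⟨Rep.ofHom ⟨φ, fun g => LinearMap.ext fun m => ?_⟩, HeckeModule.hom_ext fun H m => ?_⟩
  · exact key (H := F.bot) g (fixedPtsMk m (mem_fixedPts_bot M m))
  · apply fixedPtsVal_injective
    have := key (1 : G) m
    rw [map_one, map_one] at this
    exact this

theorem fixedPointMap_injective {f g : M ⟶ N}
    (h : fixedPointMap F f = fixedPointMap F g) : f = g := by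
  apply Rep.hom_ext
  apply Representation.IntertwiningMap.ext
  ext m
  exact congr(fixedPtsVal N F.bot (eval $h F.bot (fixedPtsMk m (mem_fixedPts_bot M m))))

instance : (fixedPointFunctorial (R := R) F).Full where
  map_surjective := fixedPointMap_surjective

instance : (fixedPointFunctorial (R := R) F).Faithful where
  map_injective := fixedPointMap_injective

end FixedPointFunctor

/-! ### Projective Hecke modules -/

section Projectives

variable {R : Type v} [CommRing R] {G : Type u} [Group G] {F : FiniteSubgroupFamily G}

open HeckeModule

variable {I : Type max u v} (H : I → F.carrier) {P Q : HeckeModule R F}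

/-- The canonical generator `Hᵢ` of the fixed point functor of `R[∐ G/Hᵢ]`. -/
noncomputable def permSumGen (i : I) : (fixedPointFunctor F (permSum R H)).val (H i) :=
  fixedPtsMk ((permSumι H i).hom (cosetElt R (H i).1 1))
    (hom_mem_fixedPts _ fun h => cosetElt_fixed (H i).1 h)

theorem orbitHom_permSumGen (i : I) : orbitHom (permSumGen (R := R) H i) = permSumι H i := by
  apply permModule_mor_ext
  rw [orbitHom_cosetElt_one]
  rfl

theorem orbitHom_add {M : Rep.{max u v} R G} {K : F.carrier}
    (x y : (fixedPointFunctor F M).val K) : orbitHom (x + y) = orbitHom x + orbitHom y := by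
  apply permModule_mor_ext
  rw [orbitHom_cosetElt_one, map_add, ← orbitHom_cosetElt_one, ← orbitHom_cosetElt_one]
  rfl

theorem orbitHom_smul {M : Rep.{max u v} R G} {K : F.carrier} (r : R)
    (x : (fixedPointFunctor F M).val K) : orbitHom (r • x) = r • orbitHom x := by
  apply permModule_mor_ext
  rw [orbitHom_cosetElt_one, map_smul, ← orbitHom_cosetElt_one]
  rfl

theorem finite_support_act (p : ∀ i, P.val (H i)) {K : F.carrier}
    (y : (fixedPointFunctor F (permSum R H)).val K) :
    Function.HasFiniteSupport fun i => P.act (orbitHom y ≫ permSumπ H i) (p i) := by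
  refine (finite_permSumπ_ne_zero H (fixedPtsVal _ K y)).subset fun i hi h => hi ?_
  have h0 : orbitHom y ≫ permSumπ H i = 0 := by
    apply permModule_mor_ext
    change (permSumπ H i).hom ((orbitHom y).hom _) = 0
    rw [orbitHom_cosetElt_one, h]
  change P.act (orbitHom y ≫ permSumπ H i) (p i) = 0
  rw [h0, act_zero, LinearMap.zero_apply]

/-- The fixed point functor of `R[∐ G/Hᵢ]` is the coproduct of the functors represented by the
`G/Hᵢ`: elements `pᵢ ∈ P(G/Hᵢ)` determine a morphism to `P`. -/
noncomputable def permSumDesc (p : ∀ i, P.val (H i)) : fixedPointFunctor F (permSum R H) ⟶ P :=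
  mkHom (fun K =>
    { toFun := fun y => ∑ᶠ i, P.act (orbitHom y ≫ permSumπ H i) (p i)
      map_add' := fun y z => by
        rw [← finsum_add_distrib (finite_support_act H p y) (finite_support_act H p z)]
        refine finsum_congr fun i => ?_
        rw [orbitHom_add, Preadditive.add_comp, act_add, LinearMap.add_apply]
      map_smul' := fun r y => by
        rw [RingHom.id_apply, smul_finsum' r (finite_support_act H p y)]
        refine finsum_congr fun i => ?_
        rw [orbitHom_smul, Linear.smul_comp, act_smul, LinearMap.smul_apply] })
    (fun {K L} f y => by
      change ∑ᶠ i, _ = P.act f (∑ᶠ i, _)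
      rw [map_finsum _ (finite_support_act H p y)]
      refine finsum_congr fun i => ?_
      rw [orbitHom_act, Category.assoc, act_comp])

theorem eval_permSumDesc (p : ∀ i, P.val (H i)) {K : F.carrier}
    (y : (fixedPointFunctor F (permSum R H)).val K) :
    eval (permSumDesc H p) K y = ∑ᶠ i, P.act (orbitHom y ≫ permSumπ H i) (p i) := rfl

theorem eval_permSumDesc_gen (p : ∀ i, P.val (H i)) (i : I) :
    eval (permSumDesc H p) (H i) (permSumGen H i) = p i := by
  rw [eval_permSumDesc, finsum_eq_single _ i, orbitHom_permSumGen, permSumι_π_self, act_id]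
  intro j hj
  rw [orbitHom_permSumGen, permSumι_π_of_ne H hj.symm, act_zero, LinearMap.zero_apply]

theorem permSum_eq_finsum_act {K : F.carrier} (y : (fixedPointFunctor F (permSum R H)).val K) :
    y = ∑ᶠ i, (fixedPointFunctor F (permSum R H)).act (orbitHom y ≫ permSumπ H i)
      (permSumGen H i) := by
  apply fixedPtsVal_injective
  rw [map_finsum _ (finite_support_act H _ y)]
  conv_lhs => rw [← finsum_permSumι_π H (fixedPtsVal _ K y)]
  refine finsum_congr fun i => ?_
  rw [fixedPtsVal_act, orbitHom_permSumGen, ← orbitHom_cosetElt_one]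
  rfl

theorem eq_permSumDesc (f : fixedPointFunctor F (permSum R H) ⟶ P) :
    f = permSumDesc H fun i => eval f (H i) (permSumGen H i) := by
  refine HeckeModule.hom_ext fun K y => ?_
  rw [eval_permSumDesc]
  conv_lhs => rw [permSum_eq_finsum_act H y]
  rw [map_finsum _ (finite_support_act H _ y)]
  refine finsum_congr fun i => ?_
  rw [eval_act]

theorem permSum_hom_ext {f g : fixedPointFunctor F (permSum R H) ⟶ P}
    (h : ∀ i, eval f (H i) (permSumGen H i) = eval g (H i) (permSumGen H i)) : f = g := by
  rw [eq_permSumDesc H f, eq_permSumDesc H g]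
  simp only [h]

instance projective_permSum : Projective (fixedPointFunctor F (permSum R H)) where
  factors {P Q} f η _ := by
    choose p hp using fun i => surjective_of_epi η (H i) (eval f (H i) (permSumGen H i))
    refine ⟨permSumDesc H p, permSum_hom_ext H fun i => ?_⟩
    rw [eval_comp, eval_permSumDesc_gen, hp]

/-- Every Hecke module is an objectwise surjective image of the fixed point functor of a permutation
module with stabilizers in `F`. -/
theorem exists_permSum_surjective (P : HeckeModule R F) :
    ∃ (I : Type max u v) (H : I → F.carrier) (η : fixedPointFunctor F (permSum R H) ⟶ P),
      ∀ K, Function.Surjective (eval η K) :=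
  ⟨Σ K : F.carrier, P.val K, Sigma.fst, permSumDesc _ Sigma.snd, fun K p =>
    ⟨permSumGen (R := R) (I := Σ K : F.carrier, P.val K) Sigma.fst ⟨K, p⟩,
      eval_permSumDesc_gen (I := Σ K : F.carrier, P.val K) Sigma.fst Sigma.snd ⟨K, p⟩⟩⟩

variable (F) in
/-- A direct summand of a permutation module with stabilizers in `F`. -/
def IsPermProjective (M : Rep.{max u v} R G) : Prop :=
  ∃ (I : Type max u v) (H : I → F.carrier), Nonempty (Retract M (permSum R H))

theorem isPermProjective_permSum : IsPermProjective F (permSum R H) :=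
  ⟨I, H, ⟨Retract.refl _⟩⟩

theorem IsPermProjective.of_retract {M N : Rep.{max u v} R G} (h : IsPermProjective F N)
    (r : Retract M N) : IsPermProjective F M := by
  obtain ⟨I, H, ⟨s⟩⟩ := h
  exact ⟨I, H, ⟨r.trans s⟩⟩

theorem IsPermProjective.projective {M : Rep.{max u v} R G} (h : IsPermProjective F M) :
    Projective (fixedPointFunctor F M) := by
  obtain ⟨I, H, ⟨s⟩⟩ := h
  have : Projective ((fixedPointFunctorial F).obj (permSum R H)) := projective_permSum H
  exact (s.map (fixedPointFunctorial F)).projective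

/-- The projective Hecke modules are the fixed point functors of the direct summands of permutation
modules with stabilizers in `F`. -/
theorem exists_iso_fixedPointFunctor (P : HeckeModule R F) [Projective P] :
    ∃ M : Rep.{max u v} R G, IsPermProjective F M ∧ Nonempty (fixedPointFunctor F M ≅ P) := by
  obtain ⟨I, H, η, hη⟩ := exists_permSum_surjective P
  have := epi_of_surjective η hη
  let s : P ⟶ fixedPointFunctor F (permSum R H) := Projective.factorThru (𝟙 P) η
  have hs : s ≫ η = 𝟙 P := Projective.factorThru_comp _ _
  obtain ⟨e, he⟩ := fixedPointMap_surjective (η ≫ s)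
  have hee : e ≫ e = e := by
    apply (fixedPointFunctorial F).map_injective
    rw [Functor.map_comp]
    change fixedPointMap F e ≫ fixedPointMap F e = fixedPointMap F e
    rw [he, Category.assoc, reassoc_of% hs]
  obtain ⟨M, i, p, hip, hpi⟩ := IsIdempotentComplete.idempotents_split _ e hee
  have h1 : fixedPointMap F i ≫ fixedPointMap F p = 𝟙 _ :=
    ((fixedPointFunctorial F).map_comp i p).symm.trans
      ((congrArg _ hip).trans ((fixedPointFunctorial F).map_id M))
  have h2 : fixedPointMap F p ≫ fixedPointMap F i = η ≫ s :=
    ((fixedPointFunctorial F).map_comp p i).symm.trans ((congrArg _ hpi).trans he)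
  refine ⟨M, ⟨I, H, ⟨⟨i, p, hip⟩⟩⟩, ⟨⟨fixedPointMap F i ≫ η, s ≫ fixedPointMap F p, ?_, ?_⟩⟩⟩
  · rw [Category.assoc, ← reassoc_of% h2, h1, Category.comp_id, h1]
  · rw [Category.assoc, reassoc_of% h2, hs, Category.comp_id, hs]

end Projectives

/-! ### Equivariant lifting -/

section Lifting

/-- A stable relation between a `Γ`-set `X` and a representation `V` contains the graph of an
equivariant map, as soon as each `x` is related to a vector fixed by its stabilizer: choose such
vectors for representatives of the orbits. -/
theorem exists_equivariant_selection {R Γ X V : Type*} [CommSemiring R] [Group Γ] [MulAction Γ X]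
    [AddCommMonoid V] [Module R V] (ρ : Representation R Γ V) (T : X → Set V)
    (hT : ∀ (γ : Γ) x v, v ∈ T x → ρ γ v ∈ T (γ • x))
    (hex : ∀ x, ∃ v ∈ T x, ∀ γ ∈ MulAction.stabilizer Γ x, ρ γ v = v) :
    ∃ f : X → V, (∀ (γ : Γ) x, f (γ • x) = ρ γ (f x)) ∧ ∀ x, f x ∈ T x := by
  choose v hv hfix using hex
  let r : X → X := fun x => (Quotient.mk (MulAction.orbitRel Γ X) x).out
  have hr (γ : Γ) (x : X) : r (γ • x) = r x :=
    congrArg Quotient.out (Quotient.sound (s := MulAction.orbitRel Γ X) ⟨γ, rfl⟩)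
  have hg (x : X) : ∃ γ : Γ, γ • r x = x := by
    obtain ⟨γ, h⟩ := Quotient.mk_out (s := MulAction.orbitRel Γ X) x
    exact ⟨γ⁻¹, inv_smul_eq_iff.2 h.symm⟩
  choose g hg using hg
  refine ⟨fun x => ρ (g x) (v (r x)), fun γ x => ?_, fun x => ?_⟩
  · have h : ρ ((g (γ • x))⁻¹ * (γ * g x)) (v (r x)) = v (r x) := by
      refine hfix _ _ ?_
      rw [MulAction.mem_stabilizer_iff, mul_smul, mul_smul, hg, inv_smul_eq_iff, ← hr γ x, hg]
    change ρ _ (v (r (γ • x))) = ρ γ (ρ (g x) (v (r x)))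
    rw [hr]
    conv_lhs => rw [← h]
    rw [← Module.End.mul_apply, ← Module.End.mul_apply, ← map_mul, ← map_mul, mul_inv_cancel_left]
  · have := hT (g x) _ _ (hv (r x))
    rwa [hg] at this

variable {R : Type v} [CommRing R] {G : Type u} [Group G] {F : FiniteSubgroupFamily G}

theorem FiniteSubgroupFamily.stabilizer_mem {K : Subgroup G} (hK : K ∈ F.carrier) (x : G ⧸ K) :
    MulAction.stabilizer G x ∈ F.carrier := by
  induction x using QuotientGroup.induction_on with
  | H g =>
    have h := MulAction.stabilizer_smul_eq_stabilizer_map_conj g ((1 : G) : G ⧸ K)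
    rw [MulAction.stabilizer_quotient] at h
    have h1 : g • ((1 : G) : G ⧸ K) = (g : G ⧸ K) := by
      rw [MulAction.Quotient.smul_coe, smul_eq_mul, mul_one]
    rw [← h1, h]
    exact F.conj_mem K hK g

theorem FiniteSubgroupFamily.stabilizer_sigma_mem {I : Type*} (H : I → F.carrier)
    (x : Σ i, G ⧸ (H i).1) : MulAction.stabilizer G x ∈ F.carrier := by
  refine F.mem_of_le _ (F.stabilizer_mem (H x.1).2 x.2) _ fun g hg => ?_
  obtain ⟨i, x⟩ := x
  rw [MulAction.mem_stabilizer_iff] at hg ⊢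
  exact eq_of_heq (Sigma.mk.inj hg).2

/-- Over any subgroup `S` of `G`, direct summands of permutation modules with stabilizers in `F`
are projective with respect to maps that are surjective on `L`-fixed points for `L ∈ F`. -/
theorem IsPermProjective.exists_lift {M B C : Rep.{max u v} R G} (hM : IsPermProjective F M)
    (S : Subgroup G) (f : B ⟶ C) (φ : Rep.res S.subtype M ⟶ Rep.res S.subtype C)
    (hφ : ∀ L ∈ F.carrier, ∀ m : M.V, φ.hom m ∈ fixedPts C L →
      ∃ b ∈ fixedPts B L, f.hom b = φ.hom m) :
    ∃ ψ : Rep.res S.subtype M ⟶ Rep.res S.subtype B, ψ ≫ Rep.resMap S.subtype f = φ := by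
  obtain ⟨I, H, ⟨r⟩⟩ := hM
  obtain ⟨l, hl, hlT⟩ := exists_equivariant_selection (Γ := S) (Rep.res S.subtype B).ρ
    (fun x : Σ i, G ⧸ (H i).1 => {b : B.V | f.hom b = φ.hom (r.r.hom (MonoidAlgebra.single x 1))})
    (fun γ x b hb => by
      change f.hom (B.ρ γ b) = φ.hom (r.r.hom (MonoidAlgebra.single ((γ : G) • x) 1))
      rw [← Representation.ofMulAction_single]
      have h1 := Rep.hom_comm_apply r.r (γ : G) (MonoidAlgebra.single x 1)
      have h2 := Rep.hom_comm_apply φ γ (r.r.hom (MonoidAlgebra.single x 1))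
      rw [Rep.hom_comm_apply]
      erw [h1, h2, hb]
      rfl)
    (fun x => by
      have hL : (MulAction.stabilizer S x).map S.subtype ∈ F.carrier := by
        refine F.mem_of_le _ (F.stabilizer_sigma_mem H x) _ ?_
        rintro _ ⟨γ, hγ, rfl⟩
        exact hγ
      obtain ⟨b, hb, hbf⟩ := hφ _ hL (r.r.hom (MonoidAlgebra.single x 1)) (by
        rintro ⟨_, γ, hγ, rfl⟩
        change C.ρ γ _ = _
        have h1 := Rep.hom_comm_apply r.r (γ : G) (MonoidAlgebra.single x 1)
        have h2 := Rep.hom_comm_apply φ γ (r.r.hom (MonoidAlgebra.single x 1))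
        have h3 : (γ : G) • x = x := hγ
        refine h2.symm.trans (congrArg φ.hom (h1.symm.trans (congrArg r.r.hom ?_)))
        rw [Representation.ofMulAction_single, h3])
      exact ⟨b, hbf, fun γ hγ => hb ⟨γ, γ, hγ, rfl⟩⟩)
  let ψ : Rep.res S.subtype (permSum R H) ⟶ Rep.res S.subtype B :=
    permLift (G := S) (Rep.res S.subtype B) l hl
  have hψ : ψ ≫ Rep.resMap S.subtype f = Rep.resMap S.subtype r.r ≫ φ := by
    refine ofMulAction_hom_ext (G := S) (X := Σ i, G ⧸ (H i).1) fun x => ?_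
    exact (congrArg f.hom (permLift_single (G := S) (Rep.res S.subtype B) l hl x)).trans (hlT x)
  have hr : Rep.resMap S.subtype r.i ≫ Rep.resMap S.subtype r.r = 𝟙 (Rep.res S.subtype M) :=
    ((Rep.resFunctor S.subtype).map_comp r.i r.r).symm.trans
      ((congrArg _ r.retract).trans ((Rep.resFunctor S.subtype).map_id M))
  exact ⟨Rep.resMap S.subtype r.i ≫ ψ, by rw [Category.assoc, hψ, reassoc_of% hr]⟩

/-- The `RG`-homomorphism `N ⊗ RX → B`, `n ⊗ x ↦ l x n`, given by an equivariant map
`l : X → Hom_R(N, B)`. -/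
noncomputable def tensorPermLift {X : Type u} [MulAction G X] {N B : Rep.{max u v} R G}
    (l : X → N.V →ₗ[R] B.V)
    (hl : ∀ (g : G) x, l (g • x) = Representation.linHom N.ρ B.ρ g (l x)) :
    Rep.of (N.ρ.tprod (Representation.ofMulAction R G X)) ⟶ B :=
  Rep.ofHom
    ⟨TensorProduct.lift (LinearMap.flip
      (Finsupp.linearCombination R l ∘ₗ (MonoidAlgebra.coeffLinearEquiv R).toLinearMap)),
      fun g => by
        ext n x
        simp [hl]⟩

theorem tensorPermLift_tmul {X : Type u} [MulAction G X] {N B : Rep.{max u v} R G}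
    (l : X → N.V →ₗ[R] B.V)
    (hl : ∀ (g : G) x, l (g • x) = Representation.linHom N.ρ B.ρ g (l x)) (n : N.V) (x : X) :
    (tensorPermLift l hl).hom (n ⊗ₜ[R] MonoidAlgebra.single x 1) = l x n := by
  change TensorProduct.lift _ _ = _
  simp

/-- An `F`-projective module lifts along every map that splits onto its image over all members
of `F`. -/
theorem IsFProjective.exists_lift {P B C : Rep.{max u v} R G} (hP : IsFProjective F P)
    (f : B ⟶ C) (hf : ∀ H ∈ F.carrier, SplitsOver H f) (φ : P ⟶ C)
    (hφ : ∀ p : P.V, φ.hom p ∈ f.hom.range) : ∃ ψ : P ⟶ B, ψ ≫ f = φ := by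
  obtain ⟨N, ⟨r⟩⟩ := hP
  let φ' := r.r ≫ φ
  have hφ' (n : N.V) (δ : F.Delta) : φ'.hom (n ⊗ₜ[R] MonoidAlgebra.single δ 1) ∈ f.hom.range :=
    hφ _
  have hcomm (g : G) (n : N.V) (δ : F.Delta) : C.ρ g (φ'.hom (n ⊗ₜ[R] MonoidAlgebra.single δ 1)) =
      φ'.hom (N.ρ g n ⊗ₜ[R] MonoidAlgebra.single (g • δ) 1) := by
    rw [← Rep.hom_comm_apply]
    refine congrArg φ'.hom ?_
    rw [Rep.of_ρ, Representation.tprod_apply, TensorProduct.map_tmul,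
      Representation.ofMulAction_single]
  obtain ⟨l, hl, hlT⟩ := exists_equivariant_selection (Representation.linHom N.ρ B.ρ)
    (fun δ : F.Delta =>
      {l : N.V →ₗ[R] B.V | ∀ n, f.hom (l n) = φ'.hom (n ⊗ₜ[R] MonoidAlgebra.single δ 1)})
    (fun γ δ l hl n => by
      rw [Representation.linHom_apply, LinearMap.comp_apply, LinearMap.comp_apply,
        Rep.hom_comm_apply, hl, hcomm, ← Module.End.mul_apply, ← map_mul, mul_inv_cancel, map_one,
        Module.End.one_apply])
    (fun δ => by
      obtain ⟨s, hs⟩ := hf _ (F.stabilizer_sigma_mem id δ)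
      let t : N.V →ₗ[R] f.hom.range.toSubmodule := LinearMap.codRestrict _
        (φ'.hom.toLinearMap ∘ₗ (TensorProduct.mk R N.V _).flip (MonoidAlgebra.single δ 1))
        (fun n => hφ' n δ)
      refine ⟨s.toLinearMap ∘ₗ t, fun n => hs (t n), fun γ hγ => LinearMap.ext fun n => ?_⟩
      rw [Representation.linHom_apply, LinearMap.comp_apply, LinearMap.comp_apply,
        LinearMap.comp_apply, LinearMap.comp_apply]
      refine (Representation.IntertwiningMap.isIntertwining _ _ s
        (⟨γ, hγ⟩ : MulAction.stabilizer G δ) (t (N.ρ γ⁻¹ n))).symm.trans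
        (congrArg s (Subtype.ext ?_))
      refine (hcomm γ (N.ρ γ⁻¹ n) δ).trans ?_
      rw [← Module.End.mul_apply, ← map_mul, mul_inv_cancel, map_one,
        Module.End.one_apply, MulAction.mem_stabilizer_iff.1 hγ]
      rfl)
  have hψ : tensorPermLift l hl ≫ f = φ' := by
    apply Rep.hom_ext
    apply Representation.IntertwiningMap.ext
    ext n δ
    exact (congrArg f.hom (tensorPermLift_tmul l hl n δ)).trans (hlT δ n)
  exact ⟨r.i ≫ tensorPermLift l hl, by rw [Category.assoc, hψ, r.retract_assoc]⟩

/-- A permutation module `R[X]` with stabilizers in `F` is a direct summand of `R[X] ⊗ RΔ`, via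
`x ↦ x ⊗ δ(x)` for an equivariant map `δ : X → Δ`. -/
theorem IsPermProjective.isFProjective {M : Rep.{max u v} R G} (hM : IsPermProjective F M) :
    IsFProjective F M := by
  obtain ⟨I, H, ⟨r⟩⟩ := hM
  let N := permSum R H
  let i : N ⟶ Rep.of (N.ρ.tprod (Representation.ofMulAction R G F.Delta)) :=
    permLift _ (fun x => MonoidAlgebra.single x 1 ⊗ₜ[R] MonoidAlgebra.single ⟨H x.1, x.2⟩ 1)
      (fun g x => by
        rw [Rep.of_ρ, Representation.tprod_apply, TensorProduct.map_tmul,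
          Representation.ofMulAction_single, Representation.ofMulAction_single]
        rfl)
  let p : Rep.of (N.ρ.tprod (Representation.ofMulAction R G F.Delta)) ⟶ N :=
    tensorPermLift (fun _ => LinearMap.id) (fun g x => by
      rw [Representation.linHom_apply, LinearMap.id_comp, ← Module.End.mul_eq_comp, ← map_mul,
        mul_inv_cancel, map_one]
      rfl)
  have hip : i ≫ p = 𝟙 N := by
    refine ofMulAction_hom_ext fun x => ?_
    refine (congrArg p.hom (permLift_single _ _ _ x)).trans ?_
    exact tensorPermLift_tmul _ _ _ _
  exact ⟨N, ⟨r.trans ⟨i, p, hip⟩⟩⟩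

end Lifting

/-! ### Complexes in a preadditive category -/

section Homotopy

variable {𝒞 : Type*} [Category* 𝒞]

/-- The objects of an augmented sequence `⋯ → P 1 → P 0 → T`. -/
def augObj (T : 𝒞) (P : ℕ → 𝒞) : ℕ → 𝒞
  | 0 => T
  | i + 1 => P i

/-- The maps of an augmented sequence `⋯ → P 1 → P 0 → T`. -/
def augMap {T : 𝒞} {P : ℕ → 𝒞} (d : ∀ i, P (i + 1) ⟶ P i) (ε : P 0 ⟶ T) :
    ∀ i, augObj T P (i + 1) ⟶ augObj T P i
  | 0 => ε
  | i + 1 => d i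

variable [Preadditive 𝒞]

/-- If two augmented complexes `A` and `B` over the same object lift maps from each other and `A`
lifts maps from itself, then the comparison maps `u : A → B` and `v : B → A` satisfy
`1 - vu = dh + hd` for a homotopy `h`. Hence `d = dhd` wherever `B` vanishes. The induction only
keeps the last components of `u`, `v` and `h`. -/
theorem exists_homotopy_of_isZero {A B : ℕ → 𝒞} (d : ∀ i, A (i + 1) ⟶ A i)
    (d' : ∀ i, B (i + 1) ⟶ B i) (hd : ∀ i, d (i + 1) ≫ d i = 0) (hd' : ∀ i, d' (i + 1) ≫ d' i = 0)
    (h0 : ∃ (u : A 1 ⟶ B 1) (v : B 1 ⟶ A 1), d 1 ≫ u ≫ d' 0 = 0 ∧ d' 1 ≫ v ≫ d 0 = 0 ∧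
      (u ≫ v) ≫ d 0 = d 0)
    (hAB : ∀ i (φ : A (i + 2) ⟶ B (i + 1)), φ ≫ d' i = 0 → ∃ ψ, ψ ≫ d' (i + 1) = φ)
    (hBA : ∀ i (φ : B (i + 2) ⟶ A (i + 1)), φ ≫ d i = 0 → ∃ ψ, ψ ≫ d (i + 1) = φ)
    (hAA : ∀ i (φ : A (i + 1) ⟶ A (i + 1)), φ ≫ d i = 0 → ∃ ψ, ψ ≫ d (i + 1) = φ)
    (k : ℕ) (hk : Limits.IsZero (B (k + 1))) : ∃ h : A k ⟶ A (k + 1), d k ≫ h ≫ d k = d k := by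
  have key (k : ℕ) : ∃ (u : A (k + 1) ⟶ B (k + 1)) (v : B (k + 1) ⟶ A (k + 1))
      (h : A k ⟶ A (k + 1)), d (k + 1) ≫ u ≫ d' k = 0 ∧ d' (k + 1) ≫ v ≫ d k = 0 ∧
      (𝟙 _ - u ≫ v - d k ≫ h) ≫ d k = 0 := by
    induction k with
    | zero =>
      obtain ⟨u, v, hu, hv, huv⟩ := h0
      exact ⟨u, v, 0, hu, hv, by simp [Preadditive.sub_comp, huv]⟩
    | succ k ih =>
      obtain ⟨u, v, h, hu, hv, huv⟩ := ih
      obtain ⟨u', hu'⟩ := hAB k (d (k + 1) ≫ u) (by rw [Category.assoc, hu])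
      obtain ⟨v', hv'⟩ := hBA k (d' (k + 1) ≫ v) (by rw [Category.assoc, hv])
      obtain ⟨h', hh'⟩ := hAA k _ huv
      refine ⟨u', v', h', ?_, ?_, ?_⟩
      · rw [hu', reassoc_of% hd (k + 1), Limits.zero_comp]
      · rw [hv', reassoc_of% hd' (k + 1), Limits.zero_comp]
      · rw [Preadditive.sub_comp, Preadditive.sub_comp, Category.assoc, hv', reassoc_of% hu',
          Category.assoc, hh', Preadditive.comp_sub, Preadditive.comp_sub, reassoc_of% hd k]
        simp
  obtain ⟨u, v, h, -, -, huv⟩ := key k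
  refine ⟨h, ?_⟩
  rw [hk.eq_of_tgt u 0, Limits.zero_comp, sub_zero, Preadditive.sub_comp, Category.id_comp,
    Category.assoc, sub_eq_zero] at huv
  exact huv.symm

/-- If the differentials `d i` of an augmented complex satisfy `d = dhd` from degree `n` on, then
the complex has a truncation in degree `n` that is a direct summand: it is the image of an
idempotent endomorphism `e`, which is the identity below `n` and zero above `n`. -/
theorem exists_truncation_idempotent {T : 𝒞} {P : ℕ → 𝒞} (d : ∀ i, P (i + 1) ⟶ P i) (ε : P 0 ⟶ T)
    (hε : d 0 ≫ ε = 0) (hd : ∀ i, d (i + 1) ≫ d i = 0) (n : ℕ)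
    (hn : ∀ i, n ≤ i → ∃ h : P i ⟶ P (i + 1), d i ≫ h ≫ d i = d i) :
    ∃ e : ∀ i, P i ⟶ P i, (∀ i, e i ≫ e i = e i) ∧ (∀ i, d i ≫ e i = e (i + 1) ≫ d i) ∧
      e 0 ≫ ε = ε ∧ ∀ i, n < i → e i = 0 := by
  -- below degree `n` the maps `h i` are irrelevant
  have hn' (i : ℕ) : ∃ h : P i ⟶ P (i + 1), n ≤ i → d i ≫ h ≫ d i = d i := by
    by_cases hi : n ≤ i
    · obtain ⟨h, hh⟩ := hn i hi
      exact ⟨h, fun _ => hh⟩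
    · exact ⟨0, fun h => absurd h hi⟩
  choose h hh using hn'
  let e (i : ℕ) : P i ⟶ P i := if i < n then 𝟙 _ else if i = n then 𝟙 _ - h i ≫ d i else 0
  have e_lt {i : ℕ} (hi : i < n) : e i = 𝟙 _ := if_pos hi
  have e_eq {i : ℕ} (hi : i = n) : e i = 𝟙 _ - h i ≫ d i := by simp [e, hi]
  have e_gt {i : ℕ} (hi : n < i) : e i = 0 := by simp [e, hi.not_gt, hi.ne']
  refine ⟨e, fun i => ?_, fun i => ?_, ?_, fun i => e_gt⟩
  · obtain hi | hi | hi := lt_trichotomy i n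
    · rw [e_lt hi, Category.comp_id]
    · simp [e_eq hi, hh i hi.ge]
    · rw [e_gt hi, Limits.zero_comp]
  · obtain hi | hi | hi := lt_trichotomy i n
    · rw [e_lt hi, Category.comp_id]
      obtain hi' | hi' := Nat.lt_or_eq_of_le (Nat.succ_le_of_lt hi)
      · rw [e_lt hi', Category.id_comp]
      · rw [e_eq hi', Preadditive.sub_comp, Category.assoc, hd, Limits.comp_zero, sub_zero,
          Category.id_comp]
    · rw [e_eq hi, e_gt (hi ▸ Nat.lt_succ_self i), Preadditive.comp_sub, hh i hi.ge,
        Category.comp_id, sub_self, Limits.zero_comp]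
    · rw [e_gt hi, e_gt (Nat.lt_succ_of_lt hi), Limits.zero_comp, Limits.comp_zero]
  · obtain hi | hi := Nat.eq_zero_or_pos n
    · rw [e_eq hi.symm, Preadditive.sub_comp, Category.assoc, hε, Limits.comp_zero, sub_zero,
        Category.id_comp]
    · rw [e_lt hi, Category.id_comp]

end Homotopy

/-- A retract of an exact sequence is exact. -/
theorem exact_of_retract {A B C A' B' C' : Type*} [Zero C] [Zero C'] {f : A → B} {g : B → C}
    {f' : A' → B'} {g' : B' → C'} (hfg : Function.Exact f g) (iA : A' → A) (iB : B' → B)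
    (iC : C' → C) (pA : A → A') (pB : B → B') (iC_zero : iC 0 = 0)
    (iC_inj : Function.Injective iC) (hpi : ∀ b, pB (iB b) = b) (hif : ∀ a, iB (f' a) = f (iA a))
    (hig : ∀ b, iC (g' b) = g (iB b)) (hpf : ∀ a, pB (f a) = f' (pA a)) :
    Function.Exact f' g' := fun b => by
  constructor
  · intro hb
    obtain ⟨a, ha⟩ := (hfg (iB b)).1 (by rw [← hig, hb, iC_zero])
    exact ⟨pA a, by rw [← hpf, ha, hpi]⟩
  · rintro ⟨a, rfl⟩
    apply iC_inj
    rw [hig, hif, iC_zero]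
    exact (hfg _).2 ⟨_, rfl⟩

/-! ### Resolutions that are exact on fixed points -/

section Resolutions

variable (R : Type v) [CommRing R] {G : Type u} [Group G] (F : FiniteSubgroupFamily G)

open HeckeModule

/-- A resolution of `R`, possibly infinite, by direct summands of permutation modules with
stabilizers in `F` that is exact on `H`-fixed points for all `H ∈ F`. -/
structure PermResolution where
  P : ℕ → Rep.{max u v} R G
  d : ∀ i, P (i + 1) ⟶ P i
  ε : P 0 ⟶ trivialRep R G
  perm : ∀ i, IsPermProjective F (P i)
  surjective : ∀ H, Function.Surjective (eval (fixedPointMap F ε) H)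
  exact_zero : ∀ H, Function.Exact (eval (fixedPointMap F (d 0)) H) (eval (fixedPointMap F ε) H)
  exact_succ : ∀ i H, Function.Exact (eval (fixedPointMap F (d (i + 1))) H)
    (eval (fixedPointMap F (d i)) H)

variable {R F}

/-- Every `RG`-module is the image of a permutation module with stabilizers in `F` under a map that
is surjective on `H`-fixed points for all `H ∈ F`. -/
theorem exists_permCover (K : Rep.{max u v} R G) :
    ∃ (C : Rep.{max u v} R G) (p : C ⟶ K), IsPermProjective F C ∧
      ∀ H, Function.Surjective (eval (fixedPointMap F p) H) := by
  obtain ⟨I, H, η, hη⟩ := exists_permSum_surjective (fixedPointFunctor F K)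
  obtain ⟨p, rfl⟩ := fixedPointMap_surjective η
  exact ⟨_, p, isPermProjective_permSum H, hη⟩

/-- The inclusion of the kernel of an `RG`-homomorphism. -/
def repKerι {M N : Rep.{max u v} R G} (f : M ⟶ N) : Rep.of f.hom.ker.toRepresentation ⟶ M :=
  Rep.ofHom ⟨f.hom.ker.toSubmodule.subtype, fun _ => rfl⟩

/-- If `p : C → ker f` is surjective on fixed points, then `C → M → N` is exact on fixed points. -/
theorem exact_comp_repKerι {C M N : Rep.{max u v} R G} (f : M ⟶ N)
    (p : C ⟶ Rep.of f.hom.ker.toRepresentation) (H : F.carrier)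
    (hp : Function.Surjective (eval (fixedPointMap F p) H)) :
    Function.Exact (eval (fixedPointMap F (p ≫ repKerι f)) H) (eval (fixedPointMap F f) H) :=
  fun m => by
  constructor
  · intro hm
    have hm' : f.hom (fixedPtsVal M H m) = 0 := congrArg (fixedPtsVal N H) hm
    obtain ⟨c, hc⟩ := hp (fixedPtsMk ⟨fixedPtsVal M H m, hm'⟩
      fun h => Subtype.ext (fixedPtsVal_mem m h))
    refine ⟨c, fixedPtsVal_injective ?_⟩
    exact congrArg (fun x => (fixedPtsVal (Rep.of f.hom.ker.toRepresentation) H x).1) hc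
  · rintro ⟨c, rfl⟩
    exact fixedPtsVal_injective (p.hom (fixedPtsVal C H c)).2

theorem exact_comp_mono {A B C D : Rep.{max u v} R G} (f : A ⟶ B) (g : B ⟶ C) (h : C ⟶ D)
    (hh : Function.Injective h.hom) (H : F.carrier)
    (hfg : Function.Exact (eval (fixedPointMap F f) H) (eval (fixedPointMap F g) H)) :
    Function.Exact (eval (fixedPointMap F f) H) (eval (fixedPointMap F (g ≫ h)) H) := fun b => by
  rw [← hfg b]
  constructor
  · intro hb
    apply fixedPtsVal_injective
    apply hh
    exact (congrArg (fixedPtsVal D H) hb).trans (by rw [map_zero, map_zero, map_zero])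
  · intro hb
    apply fixedPtsVal_injective
    exact (congrArg (fun x => h.hom (fixedPtsVal C H x)) hb).trans
      (by rw [map_zero, map_zero, map_zero])

variable (R F) in
theorem nonempty_permResolution : Nonempty (PermResolution R F) := by
  choose C p hC hp using exists_permCover (R := R) (F := F)
  -- the successive kernels
  let K : ℕ → Rep.{max u v} R G := fun n =>
    Nat.rec (trivialRep R G) (fun _ K => Rep.of (p K).hom.ker.toRepresentation) n
  have hι (i : ℕ) : Function.Injective (repKerι (p (K i))).hom := Subtype.val_injective
  exact ⟨{
    P := fun i => C (K i)
    d := fun i => p (K (i + 1)) ≫ repKerι (p (K i))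
    ε := p (K 0)
    perm := fun i => hC (K i)
    surjective := hp (K 0)
    exact_zero := fun H => exact_comp_repKerι _ _ H (hp (K 1) H)
    exact_succ := fun i H => exact_comp_mono _ _ _ (hι i) H
      (exact_comp_repKerι (p (K (i + 1))) (p (K (i + 2))) H (hp (K (i + 2)) H)) }⟩

theorem exists_fixed_preimage {A B C : Rep.{max u v} R G} {f : A ⟶ B} {g : B ⟶ C}
    (h : ∀ H, Function.Exact (eval (fixedPointMap F f) H) (eval (fixedPointMap F g) H))
    {L : Subgroup G} (hL : L ∈ F.carrier) {b : B.V} (hb : b ∈ fixedPts B L) (hgb : g.hom b = 0) :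
    ∃ a ∈ fixedPts A L, f.hom a = b := by
  obtain ⟨a, ha⟩ := (h ⟨L, hL⟩ (fixedPtsMk b hb)).1 (fixedPtsVal_injective hgb)
  exact ⟨fixedPtsVal A _ a, fixedPtsVal_mem a, congrArg (fixedPtsVal B _) ha⟩

theorem exact_of_exact_fixedPointMap {A B C : Rep.{max u v} R G} {f : A ⟶ B} {g : B ⟶ C}
    (h : ∀ H, Function.Exact (eval (fixedPointMap F f) H) (eval (fixedPointMap F g) H)) :
    Function.Exact f.hom g.hom := fun b => by
  constructor
  · intro hb
    obtain ⟨a, -, ha⟩ := exists_fixed_preimage h F.bot_mem (mem_fixedPts_bot B b) hb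
    exact ⟨a, ha⟩
  · rintro ⟨a, rfl⟩
    exact congrArg (fixedPtsVal C F.bot) ((h F.bot _).2 ⟨fixedPtsMk a (mem_fixedPts_bot A a), rfl⟩)

theorem SplitsOver.of_comp_eq {S : Subgroup G} {A B : Rep.{max u v} R G} {f : A ⟶ B}
    (s : Rep.res S.subtype B ⟶ Rep.res S.subtype A)
    (hs : Rep.resMap S.subtype f ≫ s ≫ Rep.resMap S.subtype f = Rep.resMap S.subtype f) :
    SplitsOver S f := by
  refine ⟨⟨s.hom.toLinearMap ∘ₗ f.hom.range.toSubmodule.subtype, fun g => LinearMap.ext fun y =>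
    Rep.hom_comm_apply s g y.1⟩, ?_⟩
  rintro ⟨_, a, rfl⟩
  exact congr(($hs).hom a)

theorem isZero_fixedPointFunctor_iff {M : Rep.{max u v} R G} :
    Limits.IsZero (fixedPointFunctor F M) ↔ Limits.IsZero M := by
  rw [Limits.IsZero.iff_id_eq_zero, Limits.IsZero.iff_id_eq_zero]
  have h1 : (fixedPointFunctorial F).map (𝟙 M) = 𝟙 (fixedPointFunctor F M) :=
    (fixedPointFunctorial F).map_id M
  have h2 : (fixedPointFunctorial F).map (0 : M ⟶ M) = 0 := (fixedPointFunctorial F).map_zero M M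
  rw [← h1]
  refine ⟨fun h => (fixedPointFunctorial F).map_injective (h.trans h2.symm), fun h => ?_⟩
  rw [h]
  exact h2

namespace PermResolution

variable (C : PermResolution R F)

theorem d_comp_ε : C.d 0 ≫ C.ε = 0 :=
  Rep.hom_ext (Representation.IntertwiningMap.ext (LinearMap.ext fun a =>
    (exact_of_exact_fixedPointMap C.exact_zero _).2 ⟨a, rfl⟩))

theorem d_comp_d (i : ℕ) : C.d (i + 1) ≫ C.d i = 0 :=
  Rep.hom_ext (Representation.IntertwiningMap.ext (LinearMap.ext fun a =>
    (exact_of_exact_fixedPointMap (C.exact_succ i) _).2 ⟨a, rfl⟩))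

theorem surjective_ε : Function.Surjective C.ε.hom := fun r => by
  obtain ⟨a, ha⟩ := C.surjective F.bot (fixedPtsMk r (mem_fixedPts_bot _ r))
  exact ⟨fixedPtsVal _ _ a, congrArg (fixedPtsVal _ _) ha⟩

/-- Over a member `S` of `F` the resolution is contractible: a fixed preimage of `1` splits the
augmentation, and `1 - s d` lifts to the next component of the contraction. -/
theorem exists_contraction {S : Subgroup G} (hS : S ∈ F.carrier) (i : ℕ) :
    ∃ s : Rep.res S.subtype (augObj (trivialRep R G) C.P i) ⟶
        Rep.res S.subtype (augObj (trivialRep R G) C.P (i + 1)),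
      Rep.resMap S.subtype (augMap C.d C.ε i) ≫ s ≫ Rep.resMap S.subtype (augMap C.d C.ε i) =
        Rep.resMap S.subtype (augMap C.d C.ε i) := by
  have extend {A₂ A₁ A₀ : Rep.{max u v} R G} (f : A₂ ⟶ A₁) (g : A₁ ⟶ A₀)
      (hA : IsPermProjective F A₁)
      (h : ∀ H, Function.Exact (eval (fixedPointMap F f) H) (eval (fixedPointMap F g) H))
      (s : Rep.res S.subtype A₀ ⟶ Rep.res S.subtype A₁)
      (hs : Rep.resMap S.subtype g ≫ s ≫ Rep.resMap S.subtype g = Rep.resMap S.subtype g) :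
      ∃ t : Rep.res S.subtype A₁ ⟶ Rep.res S.subtype A₂,
        Rep.resMap S.subtype f ≫ t ≫ Rep.resMap S.subtype f = Rep.resMap S.subtype f := by
    have h0 : (𝟙 (Rep.res S.subtype A₁) - Rep.resMap S.subtype g ≫ s) ≫ Rep.resMap S.subtype g =
        0 := by
      rw [Preadditive.sub_comp, Category.assoc, hs, Category.id_comp, sub_self]
    have hfg : Rep.resMap S.subtype f ≫ Rep.resMap S.subtype g = 0 :=
      Rep.hom_ext (Representation.IntertwiningMap.ext (LinearMap.ext fun a =>
        (exact_of_exact_fixedPointMap h _).2 ⟨a, rfl⟩))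
    obtain ⟨t, ht⟩ := hA.exists_lift S f (𝟙 _ - Rep.resMap S.subtype g ≫ s)
      fun L hL m hm => exists_fixed_preimage h hL hm (congr(($h0).hom m))
    exact ⟨t, by rw [ht, Preadditive.comp_sub, reassoc_of% hfg, Limits.zero_comp, sub_zero,
      Category.comp_id]⟩
  induction i with
  | zero =>
    obtain ⟨a, ha⟩ := C.surjective ⟨S, hS⟩ (fixedPtsMk (ULift.up 1) fun _ => rfl)
    let l : ULift.{u} R →ₗ[R] (C.P 0).V := (LinearMap.toSpanSingleton R _ (fixedPtsVal _ _ a)) ∘ₗ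
      ULift.moduleEquiv.toLinearMap
    have hl (r : ULift.{u} R) : C.ε.hom (l r) = r := by
      have h1 : C.ε.hom (fixedPtsVal _ _ a) = ULift.up 1 := congrArg (fixedPtsVal _ _) ha
      change C.ε.hom (r.down • fixedPtsVal _ _ a) = r
      rw [map_smul, h1]
      exact ULift.ext _ _ (mul_one _)
    refine ⟨Rep.ofHom ⟨l, fun g => LinearMap.ext fun r => ?_⟩, ?_⟩
    · change r.down • fixedPtsVal _ _ a = (C.P 0).ρ g (r.down • fixedPtsVal _ _ a)
      rw [map_smul]
      exact congrArg _ (fixedPtsVal_mem a g).symm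
    · exact Rep.hom_ext (Representation.IntertwiningMap.ext (LinearMap.ext fun x => hl _))
  | succ i ih =>
    obtain ⟨s, hs⟩ := ih
    refine extend (augMap C.d C.ε (i + 1)) (augMap C.d C.ε i) (C.perm i) ?_ s hs
    cases i with
    | zero => exact C.exact_zero
    | succ i => exact C.exact_succ i

theorem splitsOver_ε {S : Subgroup G} (hS : S ∈ F.carrier) : SplitsOver S C.ε :=
  let ⟨s, hs⟩ := C.exists_contraction hS 0
  SplitsOver.of_comp_eq s hs

theorem splitsOver_d {S : Subgroup G} (hS : S ∈ F.carrier) (i : ℕ) : SplitsOver S (C.d i) :=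
  let ⟨s, hs⟩ := C.exists_contraction hS (i + 1)
  SplitsOver.of_comp_eq s hs

/-- A `PermResolution` that vanishes above `n` is an `F`-split resolution of length `n`. -/
def toFSplitResolution {n : ℕ} (hC : ∀ i, n < i → Limits.IsZero (C.P i)) :
    FSplitResolution R F n where
  P := C.P
  d := C.d
  ε := C.ε
  projective i := (C.perm i).isFProjective
  isZero := hC
  surjective := C.surjective_ε
  exact_zero := exact_of_exact_fixedPointMap C.exact_zero
  exact_succ i := exact_of_exact_fixedPointMap (C.exact_succ i)
  split_zero _ hS := C.splitsOver_ε hS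
  split_succ _ hS i := C.splitsOver_d hS i

/-- The fixed point functors of a `PermResolution` that vanishes above `n` form a projective
resolution of length `n`. -/
noncomputable def toHeckeResolution {n : ℕ} (hC : ∀ i, n < i → Limits.IsZero (C.P i)) :
    HeckeResolution R F n where
  P i := fixedPointFunctor F (C.P i)
  d i := fixedPointMap F (C.d i)
  ε := fixedPointMap F C.ε
  projective i := (C.perm i).projective
  isZero i hi := isZero_fixedPointFunctor_iff.2 (hC i hi)
  surjective := C.surjective
  exact_zero := C.exact_zero
  exact_succ := C.exact_succ

end PermResolution

end Resolutions

/-! ### Comparison of the two kinds of resolutions -/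

section Comparison

variable {R : Type v} [CommRing R] {G : Type u} [Group G] {F : FiniteSubgroupFamily G}

open HeckeModule

/-- A projective resolution of `R^-` consists of the fixed point functors of a `PermResolution`. -/
theorem HeckeResolution.exists_permResolution {n : ℕ} (D : HeckeResolution R F n) :
    ∃ C : PermResolution R F, ∀ i, n < i → Limits.IsZero (C.P i) := by
  have hP (i : ℕ) : ∃ M : Rep.{max u v} R G, IsPermProjective F M ∧
      Nonempty (fixedPointFunctor F M ≅ D.P i) :=
    have := D.projective i
    exists_iso_fixedPointFunctor (D.P i)
  choose M hM e using hP
  replace e := fun i => (e i).some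
  choose d hd using fun i => fixedPointMap_surjective ((e (i + 1)).hom ≫ D.d i ≫ (e i).inv)
  obtain ⟨ε, hε⟩ := fixedPointMap_surjective ((e 0).hom ≫ D.ε)
  have h1 (i H x) : eval (e i).inv H (eval (e i).hom H x) = x :=
    congr(eval $((e i).hom_inv_id) H x)
  have h2 (i H x) : eval (e i).hom H (eval (e i).inv H x) = x :=
    congr(eval $((e i).inv_hom_id) H x)
  have hd1 (i H x) : eval (e i).hom H (eval (fixedPointMap F (d i)) H x) =
      eval (D.d i) H (eval (e (i + 1)).hom H x) := by
    rw [hd, eval_comp, eval_comp, h2]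
  have hd2 (i H x) : eval (e i).inv H (eval (D.d i) H x) =
      eval (fixedPointMap F (d i)) H (eval (e (i + 1)).inv H x) := by
    rw [hd, eval_comp, eval_comp, h2]
  refine ⟨⟨M, d, ε, hM, fun H y => ?_, fun H => ?_, fun i H => ?_⟩, fun i hi =>
    isZero_fixedPointFunctor_iff.1 ((D.isZero i hi).of_iso (e i))⟩
  · obtain ⟨x, hx⟩ := D.surjective H y
    refine ⟨eval (e 0).inv H x, ?_⟩
    rw [hε, eval_comp, h2]
    exact hx
  · exact exact_of_retract (D.exact_zero H) (eval (e 1).hom H) (eval (e 0).hom H) id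
      (eval (e 1).inv H) (eval (e 0).inv H) rfl Function.injective_id (h1 0 H) (hd1 0 H)
      (fun b => by rw [hε]; rfl) (hd2 0 H)
  · exact exact_of_retract (D.exact_succ i H) (eval (e (i + 2)).hom H) (eval (e (i + 1)).hom H)
      (eval (e i).hom H) (eval (e (i + 2)).inv H) (eval (e (i + 1)).inv H) (map_zero _)
      (Function.LeftInverse.injective (h1 i H)) (h1 _ H) (hd1 _ H) (hd1 i H) (hd2 _ H)

/-- Lifting in an `F`-split exact sequence. -/
theorem IsFProjective.exists_lift_of_exact {P A B C : Rep.{max u v} R G} (hP : IsFProjective F P)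
    {f : A ⟶ B} {g : B ⟶ C} (hfg : Function.Exact f.hom g.hom)
    (hf : ∀ H ∈ F.carrier, SplitsOver H f) (φ : P ⟶ B) (hφ : φ ≫ g = 0) :
    ∃ ψ : P ⟶ A, ψ ≫ f = φ :=
  hP.exists_lift f hf φ fun p => (hfg _).1 (congr(($hφ).hom p))

/-- The image of a chain idempotent over `R` on a `PermResolution` is a `PermResolution`. -/
theorem PermResolution.exists_image (C : PermResolution R F) (e : ∀ i, C.P i ⟶ C.P i)
    (he : ∀ i, e i ≫ e i = e i) (hde : ∀ i, C.d i ≫ e i = e (i + 1) ≫ C.d i)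
    (hε : e 0 ≫ C.ε = C.ε) :
    ∃ D : PermResolution R F, ∀ i, e i = 0 → Limits.IsZero (D.P i) := by
  choose M ι p hιp hpι using fun i => IsIdempotentComplete.idempotents_split _ (e i) (he i)
  have hd1 (i) : (ι (i + 1) ≫ C.d i ≫ p i) ≫ ι i = ι (i + 1) ≫ C.d i := by
    rw [Category.assoc, Category.assoc, hpι, hde, ← hpι, Category.assoc, reassoc_of% hιp]
  have hd2 (i) : C.d i ≫ p i = p (i + 1) ≫ ι (i + 1) ≫ C.d i ≫ p i := by
    rw [reassoc_of% hpι, ← reassoc_of% hde, ← hpι, Category.assoc, hιp, Category.comp_id]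
  have hε' : p 0 ≫ ι 0 ≫ C.ε = C.ε := by rw [reassoc_of% hpι, hε]
  have toEval {A B : Rep.{max u v} R G} {f g : A ⟶ B} (h : f = g) (H : F.carrier)
      (x : (fixedPointFunctor F A).val H) :
      eval (fixedPointMap F f) H x = eval (fixedPointMap F g) H x := by rw [h]
  have hinj (i) (H : F.carrier) : Function.Injective (eval (fixedPointMap F (ι i)) H) :=
    Function.LeftInverse.injective (g := eval (fixedPointMap F (p i)) H) (toEval (hιp i) H)
  refine ⟨⟨M, fun i => ι (i + 1) ≫ C.d i ≫ p i, ι 0 ≫ C.ε,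
    fun i => (C.perm i).of_retract ⟨ι i, p i, hιp i⟩, fun H y => ?_, fun H => ?_, fun i H => ?_⟩,
    fun i hi => ?_⟩
  · obtain ⟨x, rfl⟩ := C.surjective H y
    exact ⟨eval (fixedPointMap F (p 0)) H x, toEval hε' H x⟩
  · exact exact_of_retract (C.exact_zero H) (eval (fixedPointMap F (ι 1)) H)
      (eval (fixedPointMap F (ι 0)) H) id (eval (fixedPointMap F (p 1)) H)
      (eval (fixedPointMap F (p 0)) H) rfl Function.injective_id (toEval (hιp 0) H)
      (toEval (hd1 0) H) (fun _ => rfl) (toEval (hd2 0) H)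
  · exact exact_of_retract (C.exact_succ i H) (eval (fixedPointMap F (ι (i + 2))) H)
      (eval (fixedPointMap F (ι (i + 1))) H) (eval (fixedPointMap F (ι i)) H)
      (eval (fixedPointMap F (p (i + 2))) H) (eval (fixedPointMap F (p (i + 1))) H) (map_zero _)
      (hinj i H) (toEval (hιp (i + 1)) H) (toEval (hd1 (i + 1)) H) (toEval (hd1 i) H)
      (toEval (hd2 (i + 1)) H)
  · rw [Limits.IsZero.iff_id_eq_zero]
    calc 𝟙 (M i) = ι i ≫ (p i ≫ ι i) ≫ p i := by rw [Category.assoc, reassoc_of% hιp, hιp]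
      _ = 0 := by rw [hpι, hi, Limits.zero_comp, Limits.comp_zero]

/-- Comparing a `PermResolution` with an `F`-split resolution of length `n` shows that it can be
truncated in degree `n`. -/
theorem FSplitResolution.exists_permResolution {n : ℕ} (D : FSplitResolution R F n) :
    ∃ C : PermResolution R F, ∀ i, n < i → Limits.IsZero (C.P i) := by
  obtain ⟨C⟩ := nonempty_permResolution R F
  have hD0 : D.d 0 ≫ D.ε = 0 := Rep.hom_ext (Representation.IntertwiningMap.ext
    (LinearMap.ext fun a => (D.exact_zero _).2 ⟨a, rfl⟩))
  have hD (i) : D.d (i + 1) ≫ D.d i = 0 := Rep.hom_ext (Representation.IntertwiningMap.ext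
    (LinearMap.ext fun a => (D.exact_succ i _).2 ⟨a, rfl⟩))
  have hC (i) : IsFProjective F (C.P i) := (C.perm i).isFProjective
  have liftC {P : Rep.{max u v} R G} (hP : IsFProjective F P) :
      ∀ i (φ : P ⟶ C.P i), φ ≫ augMap C.d C.ε i = 0 → ∃ ψ, ψ ≫ C.d i = φ
    | 0, φ, h => hP.exists_lift_of_exact (exact_of_exact_fixedPointMap C.exact_zero)
        (fun _ hS => C.splitsOver_d hS 0) φ h
    | i + 1, φ, h => hP.exists_lift_of_exact (exact_of_exact_fixedPointMap (C.exact_succ i))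
        (fun _ hS => C.splitsOver_d hS (i + 1)) φ h
  have liftD {P : Rep.{max u v} R G} (hP : IsFProjective F P) :
      ∀ i (φ : P ⟶ D.P i), φ ≫ augMap D.d D.ε i = 0 → ∃ ψ, ψ ≫ D.d i = φ
    | 0, φ, h => hP.exists_lift_of_exact D.exact_zero (fun _ hS => D.split_succ _ hS 0) φ h
    | i + 1, φ, h => hP.exists_lift_of_exact (D.exact_succ i)
        (fun _ hS => D.split_succ _ hS (i + 1)) φ h
  obtain ⟨u, hu⟩ := (hC 0).exists_lift D.ε (fun _ hS => D.split_zero _ hS) C.ε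
    fun p => D.surjective _
  obtain ⟨v, hv⟩ := (D.projective 0).exists_lift C.ε (fun _ hS => C.splitsOver_ε hS) D.ε
    fun p => C.surjective_ε _
  have hh (i : ℕ) (hi : n ≤ i) : ∃ h : C.P i ⟶ C.P (i + 1), C.d i ≫ h ≫ C.d i = C.d i := by
    refine exists_homotopy_of_isZero (A := augObj (trivialRep R G) C.P)
      (B := augObj (trivialRep R G) D.P) (augMap C.d C.ε) (augMap D.d D.ε) ?_ ?_
      ⟨u, v, ?_, ?_, ?_⟩ (fun j => liftD (hC (j + 1)) j) (fun j => liftC (D.projective (j + 1)) j)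
      (fun j => liftC (hC j) j) (i + 1) (D.isZero (i + 1) (Nat.lt_succ_of_le hi))
    · rintro (_ | j)
      exacts [C.d_comp_ε, C.d_comp_d j]
    · rintro (_ | j)
      exacts [hD0, hD j]
    · exact (congrArg (C.d 0 ≫ ·) hu).trans C.d_comp_ε
    · exact (congrArg (D.d 0 ≫ ·) hv).trans hD0
    · exact (Category.assoc _ _ _).trans ((congrArg (u ≫ ·) hv).trans hu)
  obtain ⟨e, he, hde, hε, he0⟩ :=
    exists_truncation_idempotent C.d C.ε C.d_comp_ε C.d_comp_d n hh
  obtain ⟨C', hC'⟩ := C.exists_image e he hde hε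
  exact ⟨C', fun i hi => hC' i (he0 i hi)⟩

end Comparison

theorem mainTheorem1 (G : Type u) [Group G] (R : Type v) [CommRing R]
    (F : FiniteSubgroupFamily G) : familyCd R F = heckeCd R F := by
  have h (n : ℕ) : Nonempty (FSplitResolution R F n) ↔ Nonempty (HeckeResolution R F n) := by
    constructor
    · rintro ⟨D⟩
      obtain ⟨C, hC⟩ := D.exists_permResolution
      exact ⟨C.toHeckeResolution hC⟩
    · rintro ⟨D⟩
      obtain ⟨C, hC⟩ := D.exists_permResolution
      exact ⟨C.toFSplitResolution hC⟩
  simp only [familyCd, heckeCd, h]
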